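/- \textbf{Conventions.} An alphabet consists of letters $x_1,x_2,\dots$ and their formal inverses $x_i^{-1}$; its size counts both. A word over it is an element of the free monoid on the alphabet; $[w]$ denotes the set of cyclic permutations of a word $w$, and a factor of $[w]$ is a contiguous subword of an element of $[w]$. A word is reduced if it contains no $xx^{-1}$ or $x^{-1}x$, and cyclically reduced if all its cyclic permutations are reduced. An \emph{(orientable) Wicks form} is a cyclic word $[u]$ over $A=\{a_1^{\pm1},a_2^{\pm1},\dots\}$ such that (i) if a letter $x$ occurs in $u$ then $x^{-1}$ occurs in $u$ exactly once; (ii) $u$ is cyclically reduced; (iii) if $xy$ is a factor of $[u]$ (with $x,y\in A$) then $y^{-1}x^{-1}$ is not. Its genus is the genus of the closed orientable surface obtained from a polygon with boundary label $u$ by identifying the sides labelled by mutually inverse letters; equivalently, $2-2g=v-e+1$, where $2e$ is the length of $u$ and $v$ is the number of classes of corners of the polygon after the identification. A Wicks form of genus $g$ is \emph{maximal} if it has length $6(2g-1)$. Two Wicks forms $[u],[u']$ are isomorphic if there is a bijection $\varphi$ of alphabets with $\varphi(a^{-1})=\varphi(a)^{-1}$ and $[\varphi(u)]=[u']$. Let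 $B$ be an alphabet and let $\Phi\colon A\to B^*$ be a map such that $\Phi(a)$ is freely reduced and $\Phi(a^{-1})=\Phi(a)^{-1}$ for all $a\in A$, extended to $A^*$ by concatenation. For a Wicks form $[u]$ of genus $g$, $(\Phi,u)$ is a \emph{genus $g$ Wicks representation} of $w\in B^*$ if $w$ is obtained from $\Phi(u')$ by free reduction for some $u'\in[u]$; it is \emph{non-cancelling} if moreover $\Phi(u')$ is cyclically reduced (so that $w=\Phi(u')$). A word $w\in B^*$ \emph{has genus $g$} if it has a non-cancelling genus $g$ Wicks representation and has no Wicks representation, cancelling or not, of genus less than $g$. Let $M(g,w)$ be the number of isomorphism classes $I$ of maximal Wicks forms of genus $g$ such that $w$ has a non-cancelling Wicks representation $(\Phi,u)$ for some $u\in I$. \textbf{Theorem 1.} There is a sequence $w_2,w_3,w_4,\dots$ of words over an alphabet $B$ of size $24$ (twelve letters and their inverses) such that (i) $w_g$ has genus $g$ for every $g\ge 2$, and (ii) $M(g,w_g)>g!$ for every $g>10^{10}$. -/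

import Mathlib

namespace WicksForms

/-- The alphabet with positive letters `α`: the pair `(a, true)` is the letter `a` and the pair
`(a, false)` is the letter `a⁻¹` (the convention of Mathlib's `FreeGroup`). -/
abbrev Letter (α : Type) : Type := α × Bool

/-- Words: elements of the free monoid on the alphabet `Letter α`. -/
abbrev Word (α : Type) : Type := List (Letter α)

/-- The fixed-point free involution `a ↦ a⁻¹` on letters. -/
def linv {α : Type} (x : Letter α) : Letter α := (x.1, !x.2)

/-- `f` is a factor of the cyclic word `[w]`: it is a (contiguous) subword of some cyclic
permutation of `w`. -/
def IsCyclicFactor {α : Type} (f w : Word α) : Prop :=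
  ∃ w' : Word α, w' ~r w ∧ f <:+: w'

/-- The cyclic word `[w]` is an orientable Wicks form. All conditions only depend on `[w]`. -/
structure IsWicksForm {α : Type} [DecidableEq α] (w : Word α) : Prop where
  /-- if a letter occurs then its inverse occurs exactly once -/
  count_linv : ∀ x ∈ w, w.count (linv x) = 1
  /-- `w` is cyclically reduced: every cyclic permutation of `w` is reduced -/
  cyclicallyReduced : ∀ w' : Word α, w' ~r w → FreeGroup.IsReduced w'
  /-- if `xy` is a factor of `[w]` then `y⁻¹x⁻¹` is not -/
  not_factor : ∀ x y : Letter α, IsCyclicFactor [x, y] w → ¬ IsCyclicFactor [linv y, linv x] w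

/-- Isomorphism of cyclic words over alphabets `Letter α` and `Letter α'`: a bijection of the
alphabets which respects inversion of letters takes the cyclic word `[w]` to `[w']`. -/
def Isomorphic {α α' : Type} (w : Word α) (w' : Word α') : Prop :=
  ∃ σ : Letter α ≃ Letter α', (∀ x, σ (linv x) = linv (σ x)) ∧ w.map σ ~r w'

/-- Gluing of corners of the polygon whose sides are labelled by `w = x₀x₁⋯xₙ₋₁`. Side `i` runs
from corner `i` to corner `i + 1` (modulo `n`). If side `j` has label inverse to side `p`, these
two sides are identified with opposite orientations, so that the initial corner `p` of side `p`
is identified with the terminal corner `j + 1` of side `j`. (The identification of the terminal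
corner of side `p` with the initial corner of side `j` is the same condition with `p` and `j`
interchanged.) -/
def CornerGlue {α : Type} (w : Word α) (p q : Fin w.length) : Prop :=
  ∃ j : Fin w.length, w.get j = linv (w.get p) ∧ (q : ℕ) = ((j : ℕ) + 1) % w.length

/-- The number of vertices of the graph which the sides of the polygon form in the surface: the
number of classes of corners under the equivalence relation generated by the gluing. -/
noncomputable def numVertices {α : Type} (w : Word α) : ℕ := Nat.card (Quot (CornerGlue w))

/-- The Euler characteristic `v - e + 1` of the closed surface obtained from the polygon with
`2e = w.length` sides labelled by the Wicks form `w` by identifying its sides in pairs. -/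
noncomputable def eulerChar {α : Type} (w : Word α) : ℤ :=
  (numVertices w : ℤ) - ((w.length / 2 : ℕ) : ℤ) + 1

/-- `w` is an orientable Wicks form of genus `g`: the closed connected orientable surface obtained
from the polygon has genus `g`, that is, Euler characteristic `2 - 2g`. (The empty word, for which
there is no polygon, is not given a genus.) -/
def IsWicksFormOfGenus {α : Type} [DecidableEq α] (g : ℕ) (w : Word α) : Prop :=
  IsWicksForm w ∧ eulerChar w = 2 - 2 * (g : ℤ)

/-- Maximal Wicks forms of genus `g`: those of length `6(2g - 1)`. -/
def IsMaximalWicksForm {α : Type} [DecidableEq α] (g : ℕ) (w : Word α) : Prop :=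
  IsWicksFormOfGenus g w ∧ (w.length : ℤ) = 6 * (2 * (g : ℤ) - 1)

/-- The value on a letter of the map `Φ` with `Φ(a⁻¹) = Φ(a)⁻¹`, given on positive letters. -/
def substLetter {α β : Type} (Φ : α → Word β) (x : Letter α) : Word β :=
  if x.2 then Φ x.1 else FreeGroup.invRev (Φ x.1)

/-- The induced map on words. No cancellation is performed. -/
def subst {α β : Type} (Φ : α → Word β) (u : Word α) : Word β :=
  u.flatMap (substLetter Φ)

/-- `(Φ, u)` is a representation of `w`: every `Φ(a)` is freely reduced and `w` is obtained from
`Φ(u)` by free reduction. -/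
def IsRepresentation {α β : Type} [DecidableEq β] (Φ : α → Word β) (u : Word α) (w : Word β) :
    Prop :=
  (∀ a, FreeGroup.IsReduced (Φ a)) ∧ FreeGroup.reduce (subst Φ u) = w

/-- A representation is non-cancelling if `Φ(u)` is cyclically reduced. -/
def IsNonCancellingRepresentation {α β : Type} [DecidableEq β] (Φ : α → Word β) (u : Word α)
    (w : Word β) : Prop :=
  IsRepresentation Φ u w ∧ ∀ v : Word β, v ~r subst Φ u → FreeGroup.IsReduced v

/-- `(Φ, u)` is a genus `g` Wicks representation of `w`; it may be cancelling. -/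
def IsWicksRep {α β : Type} [DecidableEq α] [DecidableEq β] (g : ℕ) (Φ : α → Word β)
    (u : Word α) (w : Word β) : Prop :=
  IsWicksFormOfGenus g u ∧ ∃ u' : Word α, u' ~r u ∧ IsRepresentation Φ u' w

/-- `(Φ, u)` is a non-cancelling genus `g` Wicks representation of `w`. -/
def IsNonCancellingWicksRep {α β : Type} [DecidableEq α] [DecidableEq β] (g : ℕ)
    (Φ : α → Word β) (u : Word α) (w : Word β) : Prop :=
  IsWicksFormOfGenus g u ∧ ∃ u' : Word α, u' ~r u ∧ IsNonCancellingRepresentation Φ u' w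

/-- The word `w` has genus `g`: it has a non-cancelling genus `g` Wicks representation, and it has
no Wicks representation, cancelling or not, of smaller genus. Wicks forms are taken over the
alphabet `a₀, a₁, a₂, …` and inverses. -/
def HasGenus {β : Type} [DecidableEq β] (w : Word β) (g : ℕ) : Prop :=
  (∃ (Φ : ℕ → Word β) (u : Word ℕ), IsNonCancellingWicksRep g Φ u w) ∧
    ∀ k < g, ¬ ∃ (Φ : ℕ → Word β) (u : Word ℕ), IsWicksRep k Φ u w

theorem Isomorphic.refl {α : Type} (w : Word α) : Isomorphic w w :=
  ⟨Equiv.refl _, fun _ => rfl, by simpa using List.IsRotated.refl w⟩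

theorem Isomorphic.symm {α α' : Type} {w : Word α} {w' : Word α'} (h : Isomorphic w w') :
    Isomorphic w' w := by
  obtain ⟨σ, hσ, hw⟩ := h
  refine ⟨σ.symm, fun x => ?_, ?_⟩
  · apply σ.injective
    rw [hσ, σ.apply_symm_apply, σ.apply_symm_apply]
  · simpa using (hw.map σ.symm).symm

theorem Isomorphic.trans {α α' α'' : Type} {w : Word α} {w' : Word α'} {w'' : Word α''}
    (h : Isomorphic w w') (h' : Isomorphic w' w'') : Isomorphic w w'' := by
  obtain ⟨σ, hσ, hw⟩ := h
  obtain ⟨ψ, hψ, hw'⟩ := h'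
  refine ⟨σ.trans ψ, fun x => by simp [hσ, hψ], ?_⟩
  simpa using (hw.map ψ).trans hw'

/-- Isomorphism on the maximal Wicks forms of genus `g` over the alphabet `a₀, a₁, a₂, …`. -/
def isoSetoid (g : ℕ) : Setoid {u : Word ℕ // IsMaximalWicksForm g u} where
  r u v := Isomorphic u.1 v.1
  iseqv := ⟨fun u => Isomorphic.refl u.1, fun h => h.symm, fun h h' => h.trans h'⟩

/-- `M(g, w)`: the number of isomorphism classes `I` of maximal Wicks forms of genus `g` such that
`w` has a non-cancelling Wicks representation `(Φ, u)` for some `u ∈ I`. -/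
noncomputable def M {β : Type} [DecidableEq β] (g : ℕ) (w : Word β) : ℕ∞ :=
  Set.encard {I : Quotient (isoSetoid g) |
    ∃ u : {u : Word ℕ // IsMaximalWicksForm g u}, Quotient.mk (isoSetoid g) u = I ∧
      ∃ Φ : ℕ → Word β, IsNonCancellingWicksRep g Φ u.1 w}

end WicksForms

namespace WicksForms

/-! The words are `w_g = (x₀x₁x₂x₀⁻¹x₁⁻¹x₂⁻¹)^m` with `m = 2g - 1`; put `k = g - 1`.

Genus at least `g`: counting the turns of `w_g` minus the inverse turns in reduced words gives an
antisymmetric quasimorphism of defect at most 3. In a representation by a Wicks form of genus `l`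
with `v` vertices and `2e` sides, a change of gauge makes the `v - 1` edges of a spanning tree
trivial. The other `2e - 2(v - 1) = 4l` sides have values cancelling in pairs, so the count is at
most about `12l` (`abs_quasimorphism_le`). On `w_g` it equals `6m - 1 = 12g - 7`, too large for `l <
g`.

Many forms: match every `x₀`, `x₁`, `x₂` of block `i` with the inverse letter in block `a i`, `b i`,
`c i`. If all corner classes have three elements, that is, `b = c ∘ a` and `a⁻¹ ∘ b = c + 1`, the
result is a maximal Wicks form of genus `g` (`numVertices_pairWord`). For `a i = -i` this says that
`c` carries the reflection `i ↦ -i` to `i ↦ -1 - i`. Each reflection has one fixed point and `k`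
two-cycles, so there are `k! 2^k` such `c`. At most `6m + 1` of them give isomorphic forms, since
the rotation used determines `c` (`eq_of_rotate_map`), and `2^k` beats the remaining polynomial
factor. -/

@[simp] theorem linv_linv {α : Type} (x : Letter α) : linv (linv x) = x := by
  simp [linv]

/-! ### Turn-counting quasimorphisms on free groups -/

/-- The sum of the weights `f x y` over all pairs `x y` of adjacent letters of a word. -/
def turnSum {β : Type} (f : Letter β → Letter β → ℤ) : Word β → ℤ
  | [] => 0
  | [_] => 0
  | x :: y :: l => f x y + turnSum f (y :: l)

theorem turnSum_append_cons_cons {β : Type} (f : Letter β → Letter β → ℤ) (l : Word β)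
    (x y : Letter β) (l' : Word β) :
    turnSum f (l ++ x :: y :: l') = turnSum f (l ++ [x]) + f x y + turnSum f (y :: l') := by
  induction l with
  | nil => simp [turnSum]
  | cons a l ih =>
    cases l with
    | nil => simp [turnSum]; ring
    | cons b l =>
      simp only [List.cons_append, turnSum] at ih ⊢
      rw [ih]; ring

/-- Concatenation creates only one new turn, at the junction. -/
theorem abs_turnSum_append_sub_le {β : Type} {f : Letter β → Letter β → ℤ}
    (hf : ∀ x y, |f x y| ≤ 1) (l l' : Word β) :
    |turnSum f (l ++ l') - turnSum f l - turnSum f l'| ≤ 1 := by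
  rcases l.eq_nil_or_concat with rfl | ⟨s, x, rfl⟩
  · simp [turnSum]
  · cases l' with
    | nil => simp [turnSum]
    | cons y l' =>
      have h := turnSum_append_cons_cons f s x y l'
      simp only [List.concat_eq_append, List.append_assoc, List.cons_append, List.nil_append]
      rw [h]
      convert hf x y using 2
      ring

theorem turnSum_invRev {β : Type} {f : Letter β → Letter β → ℤ}
    (hf : ∀ x y, f (linv y) (linv x) = - f x y) (l : Word β) :
    turnSum f (FreeGroup.invRev l) = - turnSum f l := by
  induction l with
  | nil => simp [turnSum]
  | cons x l ih =>
    cases l with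
    | nil => simp [turnSum, FreeGroup.invRev]
    | cons y l =>
      have e : FreeGroup.invRev (x :: y :: l)
          = FreeGroup.invRev l ++ linv y :: linv x :: [] := by
        simp [FreeGroup.invRev, linv]
      have e' : FreeGroup.invRev (y :: l) = FreeGroup.invRev l ++ [linv y] := by
        simp [FreeGroup.invRev, linv]
      rw [e, turnSum_append_cons_cons, ← e', ih, hf]
      simp [turnSum]

theorem exists_cancellation {β : Type} [DecidableEq β] (l : Word β) :
    ∀ l' : Word β, FreeGroup.IsReduced l → FreeGroup.IsReduced l' →
    ∃ s p t : Word β, l = s ++ p ∧ l' = FreeGroup.invRev p ++ t ∧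
      FreeGroup.IsReduced (s ++ t) := by
  induction l using List.reverseRecOn with
  | nil => exact fun l' _ h' => ⟨[], [], l', by simp, by simp, by simpa using h'⟩
  | append_singleton l x ih =>
    intro l' h h'
    cases l' with
    | nil => exact ⟨l ++ [x], [], [], by simp, by simp, by simpa using h⟩
    | cons y l' =>
      by_cases hxy : y = linv x
      · subst hxy
        have hl : FreeGroup.IsReduced l := h.infix ⟨[], [x], by simp⟩
        have hl' : FreeGroup.IsReduced l' := h'.infix ⟨[linv x], [], by simp⟩
        obtain ⟨s, p, t, rfl, rfl, hr⟩ := ih l' hl hl'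
        exact ⟨s, p ++ [x], t, by simp, by simp [FreeGroup.invRev, linv], hr⟩
      · refine ⟨l ++ [x], [], y :: l', by simp, by simp, ?_⟩
        unfold FreeGroup.IsReduced at *
        rw [List.isChain_append]
        refine ⟨h, h', ?_⟩
        intro a ha b hb hab
        simp at ha hb
        subst ha hb
        by_contra hne
        apply hxy
        ext
        · simp [linv, hab]
        · simp only [linv]
          cases h1 : x.2 <;> cases h2 : y.2 <;> simp_all

/-- The sum of the weights of the turns of the reduced word of an element of a free group. -/
def turnCount {β : Type} [DecidableEq β] (f : Letter β → Letter β → ℤ) (x : FreeGroup β) : ℤ :=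
  turnSum f x.toWord

theorem turnCount_one {β : Type} [DecidableEq β] (f : Letter β → Letter β → ℤ) :
    turnCount f 1 = 0 := by
  simp [turnCount, turnSum]

theorem turnCount_inv {β : Type} [DecidableEq β] {f : Letter β → Letter β → ℤ}
    (hf : ∀ x y, f (linv y) (linv x) = - f x y) (x : FreeGroup β) :
    turnCount f x⁻¹ = - turnCount f x := by
  simp [turnCount, FreeGroup.toWord_inv, turnSum_invRev hf]

/-- Write the reduced words as `s p` and `p⁻¹ t` with `s t` reduced. The contributions of `p` and
`p⁻¹` cancel, and each of the three junctions costs at most 1. -/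
theorem abs_turnCount_mul_sub_le {β : Type} [DecidableEq β] {f : Letter β → Letter β → ℤ}
    (hf : ∀ x y, |f x y| ≤ 1) (hf' : ∀ x y, f (linv y) (linv x) = - f x y)
    (x y : FreeGroup β) :
    |turnCount f (x * y) - turnCount f x - turnCount f y| ≤ 3 := by
  obtain ⟨s, p, t, hx, hy, hr⟩ := exists_cancellation x.toWord y.toWord
    FreeGroup.isReduced_toWord FreeGroup.isReduced_toWord
  have hxy : (x * y).toWord = s ++ t := by
    have e : x * y = FreeGroup.mk (s ++ t) := by
      rw [← FreeGroup.mk_toWord (x := x), ← FreeGroup.mk_toWord (x := y), hx, hy]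
      rw [← FreeGroup.mul_mk, ← FreeGroup.mul_mk, ← FreeGroup.mul_mk, ← FreeGroup.inv_mk]
      group
    rw [e, FreeGroup.toWord_mk, hr.reduce_eq]
  unfold turnCount
  rw [hxy, hx, hy]
  have h1 := abs_le.1 (abs_turnSum_append_sub_le hf s t)
  have h2 := abs_le.1 (abs_turnSum_append_sub_le hf s p)
  have h3 := abs_le.1 (abs_turnSum_append_sub_le hf (FreeGroup.invRev p) t)
  rw [turnSum_invRev hf'] at h3
  rw [abs_le]
  constructor <;> linarith [h1.1, h1.2, h2.1, h2.2, h3.1, h3.2]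

/-! ### Quasimorphisms on quadratic words -/

/-- Trivial factors cost nothing, which is why trivializing a spanning tree improves the bound. -/
theorem abs_prod_sub_sum_le {G : Type} [Group G] [DecidableEq G] {h : G → ℤ} (h1 : h 1 = 0)
    {D : ℤ} (hmul : ∀ x y, |h (x * y) - h x - h y| ≤ D) (l : List G) :
    |h l.prod - (l.map h).sum| ≤ D * (l.countP (· ≠ 1) : ℕ) := by
  induction l with
  | nil => simp [h1]
  | cons x l ih =>
    by_cases hx : x = 1
    · subst hx
      simpa [h1] using ih
    · have e : ((x :: l).countP (· ≠ 1) : ℕ) = l.countP (· ≠ 1) + 1 := by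
        rw [List.countP_cons_of_pos (by simpa using hx)]
      rw [e, List.prod_cons, List.map_cons, List.sum_cons]
      have h2 := abs_le.1 (hmul x l.prod)
      have h3 := abs_le.1 ih
      push_cast
      rw [abs_le, mul_add]
      constructor <;> linarith [h2.1, h2.2, h3.1, h3.2]


/-- In a connected graph with edges labelled by group elements, each edge given by two mutually
inverse oriented edges, a change of gauge trivializes the labels along a spanning tree. -/
theorem exists_gauge {G V X : Type} [Group G] [Fintype V] [Fintype X] (cl : X → V)
    (nxt partner : X → X)
    (hconn : ∀ S : Set V, S.Nonempty → S ≠ Set.univ → ∃ p, cl p ∈ S ∧ cl (nxt p) ∉ S)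
    (h1 : ∀ p, cl (partner p) = cl (nxt p)) (h2 : ∀ p, cl (nxt (partner p)) = cl p)
    (val : X → G) (hval : ∀ p, val (partner p) = (val p)⁻¹) (c₀ : V) :
    ∃ γ : V → G, γ c₀ = 1 ∧ ∃ T : Finset X, 2 * Fintype.card V ≤ T.card + 2 ∧
      ∀ p ∈ T, (γ (cl p))⁻¹ * val p * γ (cl (nxt p)) = 1 := by
  classical
  have key : ∀ n : ℕ, n + 1 ≤ Fintype.card V → ∃ S : Finset V, S.card = n + 1 ∧ c₀ ∈ S ∧
      ∃ γ : V → G, γ c₀ = 1 ∧ ∃ T : Finset X, 2 * n ≤ T.card ∧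
        ∀ p ∈ T, cl p ∈ S ∧ cl (nxt p) ∈ S ∧ (γ (cl p))⁻¹ * val p * γ (cl (nxt p)) = 1 := by
    intro n
    induction n with
    | zero => exact fun _ => ⟨{c₀}, by simp, by simp, fun _ => 1, rfl, ∅, by simp, by simp⟩
    | succ n ih =>
      intro hn
      obtain ⟨S, hS, hc, γ, hγ, T, hT, hT'⟩ := ih (by omega)
      obtain ⟨p, hp, hp'⟩ := hconn (S : Set V) ⟨c₀, by simpa using hc⟩ (by
        intro h
        have : S = Finset.univ := by simpa using h
        rw [this, Finset.card_univ] at hS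
        omega)
      simp only [Finset.mem_coe] at hp hp'
      set c := cl (nxt p) with hcdef
      have hne : c₀ ≠ c := fun h => hp' (h ▸ hc)
      have hpT : p ∉ T := fun h => hp' (hT' p h).2.1
      have hqT : partner p ∉ T := fun h => hp' (by
        have h3 := (hT' _ h).1
        rwa [h1] at h3)
      have hpq : p ≠ partner p := fun h => hp' (by
        rw [hcdef, ← h1, ← h]; exact hp)
      have hpc : cl p ≠ c := fun h => hp' (h ▸ hp)
      -- The edge `p` leaves the tree at the new vertex `c`; the gauge at `c` is the one value that
      -- trivializes `p`, and hence `partner p`.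
      refine ⟨insert c S, by rw [Finset.card_insert_of_notMem hp', hS], by simp [hc],
        Function.update γ c ((val p)⁻¹ * γ (cl p)), by simp [hne, hγ],
        insert p (insert (partner p) T), ?_, ?_⟩
      · rw [Finset.card_insert_of_notMem (by simp [hpq, hpT]), Finset.card_insert_of_notMem hqT]
        omega
      · intro q hq
        rw [Finset.mem_insert, Finset.mem_insert] at hq
        rcases hq with rfl | rfl | hq
        · refine ⟨by simp [hp], by simp [← hcdef], ?_⟩
          rw [← hcdef, Function.update_self, Function.update_of_ne hpc]
          group
        · refine ⟨by simp [h1, ← hcdef], by simp [h2, hp], ?_⟩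
          rw [h1, h2, ← hcdef, Function.update_self, Function.update_of_ne hpc, hval]
          group
        · obtain ⟨ha, hb, hab⟩ := hT' q hq
          refine ⟨by simp [ha], by simp [hb], ?_⟩
          rwa [Function.update_of_ne (fun h => hp' (by rwa [← h])),
            Function.update_of_ne (fun h => hp' (by rwa [← h]))]
  have hpos : 0 < Fintype.card V := Fintype.card_pos_iff.2 ⟨c₀⟩
  obtain ⟨S, -, -, γ, hγ, T, hT, hT'⟩ := key (Fintype.card V - 1) (by omega)
  exact ⟨γ, hγ, T, by omega, fun p hp => (hT' p hp).2.2⟩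

theorem prod_telescope {G V X : Type} [Group G] (at' : ℕ → X) (nxt : X → X)
    (hat : ∀ t, nxt (at' t) = at' (t + 1)) (cl : X → V) (γ : V → G) (val : X → G) (n : ℕ) :
    ((List.range n).map fun t => (γ (cl (at' t)))⁻¹ * val (at' t) * γ (cl (nxt (at' t)))).prod
      = (γ (cl (at' 0)))⁻¹ * ((List.range n).map fun t => val (at' t)).prod * γ (cl (at' n)) := by
  induction n with
  | zero => simp
  | succ n ih =>
    rw [List.range_succ, List.map_append, List.prod_append, ih, List.map_append, List.prod_append]
    simp only [List.map_cons, List.map_nil, List.prod_singleton, hat]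
    group

theorem nodup_of_count {α : Type} [DecidableEq α] {u : Word α}
    (hu : ∀ x ∈ u, u.count (linv x) = 1) : u.Nodup := by
  rw [List.nodup_iff_count_le_one]
  intro x
  by_cases hx : x ∈ u
  · have h1 : linv x ∈ u := List.count_pos_iff.1 (by rw [hu x hx]; norm_num)
    have h2 := hu _ h1
    rw [linv_linv] at h2
    exact h2.le
  · rw [List.count_eq_zero_of_not_mem hx]; norm_num

theorem rotate_eq_map_range {α : Type} (u : List α) (hn : 0 < u.length) (r : ℕ) :
    u.rotate r = (List.range u.length).map fun t =>
      u.get ⟨(t + r) % u.length, Nat.mod_lt _ hn⟩ := by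
  apply List.ext_getElem
  · simp
  · intro i h1 h2
    simp [List.getElem_rotate]

/-- An antisymmetric quasimorphism on a group is bounded on the values of a quadratic word in
terms of the Euler characteristic of the surface of that word. -/
theorem abs_quasimorphism_le {G α : Type} [Group G] [DecidableEq α] {h : G → ℤ} (hh1 : h 1 = 0)
    (hinv : ∀ x, h x⁻¹ = - h x) {D : ℤ} (hD : 0 ≤ D)
    (hmul : ∀ x y, |h (x * y) - h x - h y| ≤ D) {u u' : Word α} (hn : 0 < u.length)
    (hu : ∀ x ∈ u, u.count (linv x) = 1) (hr : u' ~r u) (val : Letter α → G)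
    (hval : ∀ x, val (linv x) = (val x)⁻¹) :
    |h (u'.map val).prod| ≤ D * (u.length + 2 - 2 * numVertices u) := by
  classical
  obtain ⟨r, rfl⟩ := hr.symm
  set n := u.length with hndef
  have hinj : Function.Injective u.get := List.nodup_iff_injective_get.1 (nodup_of_count hu)
  have hex : ∀ p : Fin n, ∃ q : Fin n, u.get q = linv (u.get p) := by
    intro p
    have h1 : linv (u.get p) ∈ u :=
      List.count_pos_iff.1 (by rw [hu _ (List.get_mem u p)]; norm_num)
    exact List.get_of_mem h1
  choose partner hpartner using hex
  have hpp : Function.Involutive partner := fun p => hinj (by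
    rw [hpartner, hpartner, linv_linv])
  let nxt : Fin n → Fin n := fun p => ⟨((p : ℕ) + 1) % n, Nat.mod_lt _ hn⟩
  let cl : Fin n → Quot (CornerGlue u) := Quot.mk _
  have hfin : Finite (Quot (CornerGlue u)) := Finite.of_surjective cl Quot.mk_surjective
  have : Fintype (Quot (CornerGlue u)) := Fintype.ofFinite _
  have h2 : ∀ p, cl (nxt (partner p)) = cl p := fun p =>
    (Quot.sound ⟨partner p, hpartner p, rfl⟩).symm
  have h1 : ∀ p, cl (partner p) = cl (nxt p) := fun p => by
    rw [← h2 (partner p), hpp p]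
  let pos : ℕ → Fin n := fun t => ⟨(t + r) % n, Nat.mod_lt _ hn⟩
  have hpos : ∀ t, nxt (pos t) = pos (t + 1) := by
    intro t
    simp only [nxt, pos, Fin.mk.injEq]
    rw [Nat.mod_add_mod]
    congr 1
    ring
  have hposn : pos n = pos 0 := by simp [pos]
  -- The boundary of the polygon runs through all corners, so a nonempty set of vertices with no
  -- edge leaving it is everything.
  have hconn : ∀ S : Set (Quot (CornerGlue u)), S.Nonempty → S ≠ Set.univ →
      ∃ p, cl p ∈ S ∧ cl (nxt p) ∉ S := by
    intro S ⟨c, hc⟩ hS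
    by_contra! hcon
    apply hS
    obtain ⟨p, rfl⟩ := Quot.mk_surjective c
    have h3 : ∀ t : ℕ, cl ⟨(p + t) % n, Nat.mod_lt _ hn⟩ ∈ S := by
      intro t
      induction t with
      | zero =>
        have hp : (p : ℕ) < n := p.2
        simpa [Nat.mod_eq_of_lt hp, cl] using hc
      | succ t ih =>
        have := hcon _ ih
        simpa [nxt, Nat.mod_add_mod, add_assoc] using this
    rw [Set.eq_univ_iff_forall]
    intro d
    obtain ⟨q, rfl⟩ := Quot.mk_surjective d
    have h4 := h3 (q + (n - p))
    have e : (⟨((p : ℕ) + (q + (n - p))) % n, Nat.mod_lt _ hn⟩ : Fin n) = q := by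
      ext
      have : (p : ℕ) + (q + (n - p)) = q + n := by have := p.2; omega
      have hq : (q : ℕ) < n := q.2
      simp [this, Nat.mod_eq_of_lt hq]
    rw [e] at h4
    exact h4
  -- The gauge is 1 at the base corner `pos 0`, so the product around the polygon is unchanged
  -- rather than conjugated.
  obtain ⟨γ, hγ, T, hT, hT'⟩ := exists_gauge cl nxt partner hconn h1 h2 (fun p => val (u.get p))
    (fun p => by rw [hpartner, hval]) (cl (pos 0))
  let Y : Fin n → G := fun p => (γ (cl p))⁻¹ * val (u.get p) * γ (cl (nxt p))
  have hY : ∀ p, Y (partner p) = (Y p)⁻¹ := by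
    intro p
    simp only [Y, h1, h2, hpartner, hval]
    group
  have hprod : ((u.rotate r).map val).prod = ((List.range n).map (Y ∘ pos)).prod := by
    have := prod_telescope pos nxt hpos cl γ (fun p => val (u.get p)) n
    rw [hposn, hγ] at this
    simp only [inv_one, one_mul, mul_one] at this
    rw [rotate_eq_map_range u hn, List.map_map]
    exact this.symm
  have hperm : ((List.range n).map pos).Perm (List.finRange n) := by
    have e : (List.range n).map pos = (List.finRange n).rotate r := by
      rw [rotate_eq_map_range _ (by simpa using hn)]
      simp [pos]
    rw [e]
    exact List.rotate_perm _ _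
  -- Paired sides carry inverse values, so the sum equals its own negative.
  have hsum : (((List.range n).map (Y ∘ pos)).map h).sum = 0 := by
    have e : (((List.range n).map (Y ∘ pos)).map h).sum = ∑ p, h (Y p) := by
      rw [← List.map_map, List.map_map, ((hperm.map (h ∘ Y))).sum_eq]
      simp [Fin.sum_univ_def, Function.comp_def]
    have e2 : ∑ p, h (Y p) = - ∑ p, h (Y p) := by
      rw [← Finset.sum_neg_distrib, ← Equiv.sum_comp hpp.toPerm]
      exact Finset.sum_congr rfl fun p _ => by
        simp [hY, hinv]
    rw [e]; linarith
  have hcount : ((List.range n).map (Y ∘ pos)).countP (· ≠ 1) + T.card ≤ n := by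
    have e : ((List.range n).map (Y ∘ pos)).countP (· ≠ 1)
        = (Finset.univ.filter fun p => Y p ≠ 1).card := by
      rw [← List.map_map, (hperm.map Y).countP_eq, List.countP_map, List.countP_eq_length_filter]
      have e' : (Finset.univ.filter fun p => Y p ≠ 1)
          = ((List.finRange n).filter ((fun x => decide (x ≠ 1)) ∘ Y)).toFinset := by
        ext p
        simp
      rw [e', List.toFinset_card_of_nodup ((List.nodup_finRange n).filter _)]
    rw [e]
    have hd : Disjoint (Finset.univ.filter fun p => Y p ≠ 1) T := by
      rw [Finset.disjoint_left]
      intro p hp hpT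
      simp only [Finset.mem_filter] at hp
      exact hp.2 (hT' p hpT)
    rw [← Finset.card_union_of_disjoint hd]
    simpa using Finset.card_le_univ ((Finset.univ.filter fun p => Y p ≠ 1) ∪ T)
  have hfinal := abs_prod_sub_sum_le hh1 hmul ((List.range n).map (Y ∘ pos))
  rw [hsum, sub_zero, ← hprod] at hfinal
  refine hfinal.trans (mul_le_mul_of_nonneg_left ?_ hD)
  have hv : numVertices u = Fintype.card (Quot (CornerGlue u)) := Nat.card_eq_fintype_card
  rw [hv]
  have := hcount
  omega

theorem prod_map_eq_mk_subst {α β : Type} (Φ : α → Word β) (u : Word α) :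
    (u.map fun x => FreeGroup.mk (substLetter Φ x)).prod = FreeGroup.mk (subst Φ u) := by
  induction u with
  | nil => rfl
  | cons x u ih =>
    rw [List.map_cons, List.prod_cons, ih, FreeGroup.mul_mk]
    rfl

/-- A word with a Wicks representation of genus `k` has turn sum at most `12 k + 3`. -/
theorem abs_turnSum_le_of_isWicksRep {α β : Type} [DecidableEq α] [DecidableEq β]
    {f : Letter β → Letter β → ℤ}
    (hf : ∀ x y, |f x y| ≤ 1) (hf' : ∀ x y, f (linv y) (linv x) = - f x y) {k : ℕ}
    {Φ : α → Word β} {u : Word α} {w : Word β} (h : IsWicksRep k Φ u w) :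
    |turnSum f w| ≤ 12 * k + 3 := by
  obtain ⟨⟨hu, hχ⟩, u', hr, -, hw⟩ := h
  -- The empty word has `eulerChar` equal to 1, which is odd.
  have hn : 0 < u.length := by
    rcases u.eq_nil_or_concat with rfl | ⟨s, x, rfl⟩
    · have : numVertices ([] : Word α) = 0 := by
        have : IsEmpty (Quot (CornerGlue ([] : Word α))) :=
          ⟨fun q => by induction q using Quot.ind with | mk p => exact p.elim0⟩
        exact Nat.card_of_isEmpty
      simp only [eulerChar, this] at hχ
      simp at hχ
      omega
    · simp
  have hval : ∀ x : Letter α, FreeGroup.mk (substLetter Φ (linv x))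
      = (FreeGroup.mk (substLetter Φ x))⁻¹ := by
    rintro ⟨a, b⟩
    cases b <;> simp [substLetter, linv, FreeGroup.inv_mk, FreeGroup.invRev_invRev]
  have key := abs_quasimorphism_le (h := turnCount f) (turnCount_one f) (turnCount_inv hf')
    (by norm_num) (abs_turnCount_mul_sub_le hf hf') hn hu.count_linv hr
    (fun x => FreeGroup.mk (substLetter Φ x)) hval
  rw [prod_map_eq_mk_subst, turnCount, FreeGroup.toWord_mk, hw] at key
  refine key.trans ?_
  -- The summand 3 absorbs the rounding in `u.length / 2`, as evenness of the length is not
  -- established.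
  unfold eulerChar at hχ
  omega


/-! ### Turns of the hexagonal torus word -/

/-- The letter which follows a letter `x` in the powers of `x₀x₁x₂x₀⁻¹x₁⁻¹x₂⁻¹`. -/
def nextLetter (x : Letter (Fin 12)) : Letter (Fin 12) :=
  if x.1 = 0 then (1, x.2) else if x.1 = 1 then (2, x.2) else
    if x.1 = 2 then (0, !x.2) else (0, x.2)

theorem nextLetter_ne_linv : ∀ x, nextLetter x ≠ linv x := by decide

/-- No turn is the inverse of a turn. This gives both the weight 1 of every turn and condition (iii)
for the Wicks forms below. -/
theorem linv_ne_nextLetter : ∀ x, linv x ≠ nextLetter (linv (nextLetter x)) := by decide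

/-- The weight `1` of the turns of the powers of `x₀x₁x₂x₀⁻¹x₁⁻¹x₂⁻¹`, and `-1` of the inverse
turns. -/
def torusTurn (x y : Letter (Fin 12)) : ℤ :=
  (if y = nextLetter x then 1 else 0) - (if linv x = nextLetter (linv y) then 1 else 0)

theorem abs_torusTurn_le (x y : Letter (Fin 12)) : |torusTurn x y| ≤ 1 := by
  unfold torusTurn
  split_ifs <;> simp

theorem torusTurn_linv (x y : Letter (Fin 12)) :
    torusTurn (linv y) (linv x) = - torusTurn x y := by
  simp [torusTurn]

theorem torusTurn_nextLetter (x : Letter (Fin 12)) : torusTurn x (nextLetter x) = 1 := by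
  simp [torusTurn, linv_ne_nextLetter]

theorem turnSum_eq_of_isChain {l : Word (Fin 12)} (hl : l ≠ [])
    (h : l.IsChain fun x y => y = nextLetter x) :
    turnSum torusTurn l + 1 = l.length := by
  induction l with
  | nil => exact absurd rfl hl
  | cons x l ih =>
    cases l with
    | nil => simp [turnSum]
    | cons y l =>
      rw [List.isChain_cons_cons] at h
      have := ih (by simp) h.2
      obtain ⟨rfl, -⟩ := h
      simp only [turnSum, torusTurn_nextLetter, List.length_cons] at this ⊢
      push_cast at this ⊢
      linarith

/-- The letter with the same sign and with index reduced modulo `3`. -/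
def letterType (x : Letter ℕ) : Letter (Fin 12) :=
  (⟨x.1 % 3, by omega⟩, x.2)

theorem letterType_linv (x : Letter ℕ) : letterType (linv x) = linv (letterType x) := rfl

theorem exists_of_isCyclicFactor {α : Type} {x y : Letter α} {w : Word α}
    (h : IsCyclicFactor [x, y] w) :
    ∃ p : Fin w.length, w.get p = x ∧
      w.get ⟨((p : ℕ) + 1) % w.length, Nat.mod_lt _ (by have := p.2; omega)⟩ = y := by
  obtain ⟨w', hr, s, t, hst⟩ := h
  obtain ⟨r, rfl⟩ := hr.symm
  have hlen : s.length + 2 + t.length = w.length := by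
    rw [← List.length_rotate w r, ← hst]
    simp
    omega
  have hn : 0 < w.length := by omega
  have h1 : (w.rotate r)[s.length]? = some x := by
    rw [← hst]; simp
  have h2 : (w.rotate r)[s.length + 1]? = some y := by
    rw [← hst]; simp
  rw [List.getElem?_rotate (by omega)] at h1 h2
  refine ⟨⟨(s.length + r) % w.length, Nat.mod_lt _ hn⟩, ?_, ?_⟩
  · obtain ⟨_, h3⟩ := List.getElem?_eq_some_iff.1 h1
    exact h3
  · obtain ⟨_, h3⟩ := List.getElem?_eq_some_iff.1 h2
    rw [← h3]
    simp only [List.get_eq_getElem, Nat.mod_add_mod]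
    congr 2
    omega

theorem isReduced_of_forall_isCyclicFactor {α : Type} {w v : Word α} (hv : v ~r w)
    (h : ∀ x, ¬ IsCyclicFactor [x, linv x] w) : FreeGroup.IsReduced v := by
  unfold FreeGroup.IsReduced
  rw [List.isChain_iff_forall_rel_of_append_cons_cons]
  intro x y s t hst hxy
  by_contra hne
  apply h x
  refine ⟨v, hv, s, t, ?_⟩
  have : linv x = y := by
    ext
    · simp [linv, hxy]
    · simp only [linv]
      cases h1 : x.2 <;> cases h2 : y.2 <;> simp_all
  rw [hst, this]
  simp

/-! ### Words in blocks of six letters -/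

/-- The word whose letters are given on positions divided into `m` blocks of length `6`. -/
def blockWord {α : Type} {m : ℕ} (l : Fin m × Fin 6 → Letter α) : Word α :=
  List.ofFn fun q : Fin (m * 6) => l (finProdFinEquiv.symm q)

theorem length_blockWord {α : Type} {m : ℕ} (l : Fin m × Fin 6 → Letter α) :
    (blockWord l).length = m * 6 := by
  simp [blockWord]

/-- The positions of a block word. -/
def blockPos {α : Type} {m : ℕ} (l : Fin m × Fin 6 → Letter α) :
    Fin (blockWord l).length ≃ Fin m × Fin 6 :=
  (finCongr (length_blockWord l)).trans finProdFinEquiv.symm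

theorem get_blockWord {α : Type} {m : ℕ} (l : Fin m × Fin 6 → Letter α)
    (p : Fin (blockWord l).length) : (blockWord l).get p = l (blockPos l p) :=
  List.get_ofFn _ _

theorem blockPos_symm_val {α : Type} {m : ℕ} (l : Fin m × Fin 6 → Letter α)
    (x : Fin m × Fin 6) : ((blockPos l).symm x : ℕ) = x.2 + 6 * x.1 := rfl

/-- The cyclic successor of a position. -/
def nextPos {m : ℕ} [NeZero m] (x : Fin m × Fin 6) : Fin m × Fin 6 :=
  if x.2 = 5 then (x.1 + 1, 0) else (x.1, x.2 + 1)

theorem blockPos_symm_nextPos {α : Type} {m : ℕ} [NeZero m] (l : Fin m × Fin 6 → Letter α)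
    (x : Fin m × Fin 6) : ((blockPos l).symm (nextPos x) : ℕ)
      = (((blockPos l).symm x : ℕ) + 1) % (blockWord l).length := by
  refine Eq.trans ?_ (congrArg (fun n => (((blockPos l).symm x : ℕ) + 1) % n)
    (length_blockWord l).symm)
  rw [blockPos_symm_val, blockPos_symm_val]
  obtain ⟨i, s⟩ := x
  have hi := i.2
  unfold nextPos
  split_ifs with h
  · simp only at h
    subst h
    have e : ((i + 1 : Fin m) : ℕ) = ((i : ℕ) + 1) % m := by
      rw [Fin.val_add]; simp
    have e2 : ((5 : Fin 6) : ℕ) + 6 * (i : ℕ) + 1 = 6 * (i + 1) := by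
      have : ((5 : Fin 6) : ℕ) = 5 := rfl
      omega
    simp only [e, e2, Fin.val_zero]
    rw [mul_comm m 6, Nat.mul_mod_mul_left]
    omega
  · have hs : (s : ℕ) < 5 := by
      simp only at h
      have : (s : ℕ) ≠ 5 := fun h' => h (Fin.ext h')
      omega
    have e : ((s + 1 : Fin 6) : ℕ) = s + 1 := by
      rw [Fin.val_add, Fin.val_one]; omega
    simp only [e]
    rw [Nat.mod_eq_of_lt (by omega)]
    ring

theorem get_next_blockWord {α : Type} {m : ℕ} [NeZero m] (l : Fin m × Fin 6 → Letter α)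
    (p : Fin (blockWord l).length) (h : ((p : ℕ) + 1) % (blockWord l).length
      < (blockWord l).length) :
    blockPos l ⟨((p : ℕ) + 1) % (blockWord l).length, h⟩ = nextPos (blockPos l p) := by
  rw [← Equiv.eq_symm_apply]
  ext
  rw [blockPos_symm_nextPos]
  simp

theorem exists_of_isCyclicFactor_blockWord {α : Type} {m : ℕ} [NeZero m]
    {l : Fin m × Fin 6 → Letter α} {x y : Letter α} (h : IsCyclicFactor [x, y] (blockWord l)) :
    ∃ z, l z = x ∧ l (nextPos z) = y := by
  obtain ⟨p, hx, hy⟩ := exists_of_isCyclicFactor h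
  refine ⟨blockPos l p, ?_, ?_⟩
  · rw [← get_blockWord l, hx]
  · rw [← get_next_blockWord l p (Nat.mod_lt _ (Fin.pos p)), ← get_blockWord l, hy]

/-- The letters of `x₀x₁x₂x₀⁻¹x₁⁻¹x₂⁻¹`. -/
def slotLetter (s : Fin 6) : Letter (Fin 12) :=
  ![(0, true), (1, true), (2, true), (0, false), (1, false), (2, false)] s

theorem slotLetter_nextPos {m : ℕ} [NeZero m] (x : Fin m × Fin 6) :
    slotLetter (nextPos x).2 = nextLetter (slotLetter x.2) := by
  obtain ⟨i, s⟩ := x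
  fin_cases s <;> simp [nextPos] <;> decide

/-- The power of `x₀x₁x₂x₀⁻¹x₁⁻¹x₂⁻¹` with exponent `m`. -/
abbrev torusWord (m : ℕ) : Word (Fin 12) :=
  blockWord fun x : Fin m × Fin 6 => slotLetter x.2

theorem not_isCyclicFactor_torusWord {m : ℕ} [NeZero m] (x : Letter (Fin 12)) :
    ¬ IsCyclicFactor [x, linv x] (torusWord m) := by
  intro h
  obtain ⟨z, rfl, h2⟩ := exists_of_isCyclicFactor_blockWord h
  rw [slotLetter_nextPos] at h2
  exact nextLetter_ne_linv _ h2

theorem isReduced_of_isRotated_torusWord {m : ℕ} [NeZero m] {v : Word (Fin 12)}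
    (hv : v ~r torusWord m) : FreeGroup.IsReduced v :=
  isReduced_of_forall_isCyclicFactor hv not_isCyclicFactor_torusWord

theorem turnSum_torusWord (m : ℕ) [NeZero m] :
    turnSum torusTurn (torusWord m) + 1 = m * 6 := by
  have hlen : (torusWord m).length = m * 6 := length_blockWord _
  have hm : 0 < m := Nat.pos_of_ne_zero (NeZero.ne m)
  rw [turnSum_eq_of_isChain (by intro h; rw [h] at hlen; simp at hlen; omega), hlen]
  · push_cast; rfl
  · rw [List.isChain_iff_forall_rel_of_append_cons_cons]
    intro x y s t hst
    obtain ⟨z, rfl, rfl⟩ := exists_of_isCyclicFactor_blockWord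
      (l := fun x : Fin m × Fin 6 => slotLetter x.2) (x := x) (y := y)
      ⟨torusWord m, List.IsRotated.refl _, s, t, by rw [hst]; simp⟩
    exact slotLetter_nextPos z

/-! ### Wicks forms from pairings of the torus word -/

/-- The letters of the Wicks form obtained from the power of `x₀x₁x₂x₀⁻¹x₁⁻¹x₂⁻¹` by pairing the
letters `x₀`, `x₁`, `x₂` of each block `i` with the letters `x₀⁻¹`, `x₁⁻¹`, `x₂⁻¹` of the blocks
`a i`, `b i`, `c i`. -/
def pairLetter {m : ℕ} (a b c : Equiv.Perm (Fin m)) (x : Fin m × Fin 6) : Letter ℕ :=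
  ![(3 * (x.1 : ℕ), true), (3 * (x.1 : ℕ) + 1, true), (3 * (x.1 : ℕ) + 2, true),
    (3 * (a.symm x.1 : ℕ), false), (3 * (b.symm x.1 : ℕ) + 1, false),
    (3 * (c.symm x.1 : ℕ) + 2, false)] x.2

/-- The position paired with a given position. -/
def partnerPos {m : ℕ} (a b c : Equiv.Perm (Fin m)) (x : Fin m × Fin 6) : Fin m × Fin 6 :=
  ![(a x.1, 3), (b x.1, 4), (c x.1, 5), (a.symm x.1, 0), (b.symm x.1, 1), (c.symm x.1, 2)] x.2

theorem letterType_pairLetter {m : ℕ} (a b c : Equiv.Perm (Fin m)) (x : Fin m × Fin 6) :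
    letterType (pairLetter a b c x) = slotLetter x.2 := by
  obtain ⟨i, s⟩ := x
  fin_cases s <;> simp [letterType, pairLetter, slotLetter, Nat.add_mod]

theorem pairLetter_injective {m : ℕ} (a b c : Equiv.Perm (Fin m)) :
    Function.Injective (pairLetter a b c) := by
  have hslot : Function.Injective slotLetter := by decide
  rintro ⟨i, s⟩ ⟨j, t⟩ h
  obtain rfl : s = t := hslot (by
    rw [← letterType_pairLetter a b c (i, s), h, letterType_pairLetter])
  fin_cases s <;> simpa [pairLetter, Fin.val_inj] using h

theorem pairLetter_partnerPos {m : ℕ} (a b c : Equiv.Perm (Fin m)) (x : Fin m × Fin 6) :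
    pairLetter a b c (partnerPos a b c x) = linv (pairLetter a b c x) := by
  obtain ⟨i, s⟩ := x
  fin_cases s <;> simp [pairLetter, partnerPos, linv]

theorem pairLetter_eq_linv_iff {m : ℕ} {a b c : Equiv.Perm (Fin m)} {x y : Fin m × Fin 6} :
    pairLetter a b c y = linv (pairLetter a b c x) ↔ y = partnerPos a b c x := by
  rw [← pairLetter_partnerPos, (pairLetter_injective a b c).eq_iff]

/-- The Wicks form given by a pairing of the letters of the power of `x₀x₁x₂x₀⁻¹x₁⁻¹x₂⁻¹`. -/
abbrev pairWord {m : ℕ} (a b c : Equiv.Perm (Fin m)) : Word ℕ := blockWord (pairLetter a b c)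

theorem nodup_pairWord {m : ℕ} (a b c : Equiv.Perm (Fin m)) : (pairWord a b c).Nodup := by
  unfold pairWord blockWord
  rw [List.nodup_ofFn]
  exact (pairLetter_injective a b c).comp finProdFinEquiv.symm.injective

/-- Conditions (ii) and (iii) are thereby inherited from the turns of the torus word, whatever the
pairing. -/
theorem nextLetter_letterType_of_isCyclicFactor {m : ℕ} [NeZero m] {a b c : Equiv.Perm (Fin m)}
    {x y : Letter ℕ} (h : IsCyclicFactor [x, y] (pairWord a b c)) :
    letterType y = nextLetter (letterType x) := by
  obtain ⟨z, rfl, rfl⟩ := exists_of_isCyclicFactor_blockWord h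
  rw [letterType_pairLetter, letterType_pairLetter, slotLetter_nextPos]

theorem isWicksForm_pairWord {m : ℕ} [NeZero m] (a b c : Equiv.Perm (Fin m)) :
    IsWicksForm (pairWord a b c) where
  count_linv x hx := by
    obtain ⟨p, rfl⟩ := List.get_of_mem hx
    apply List.count_eq_one_of_mem (nodup_pairWord a b c)
    have e : linv ((pairWord a b c).get p) = (pairWord a b c).get ((blockPos _).symm
        (partnerPos a b c (blockPos (pairLetter a b c) p))) := by
      unfold pairWord
      rw [get_blockWord, get_blockWord, Equiv.apply_symm_apply, pairLetter_partnerPos]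
    rw [e]
    exact List.get_mem _ _
  cyclicallyReduced v hv := isReduced_of_forall_isCyclicFactor hv fun x h => by
    have := nextLetter_letterType_of_isCyclicFactor h
    rw [letterType_linv] at this
    exact nextLetter_ne_linv _ this.symm
  not_factor x y h h' := by
    have h1 := nextLetter_letterType_of_isCyclicFactor h
    have h2 := nextLetter_letterType_of_isCyclicFactor h'
    rw [letterType_linv, letterType_linv, h1] at h2
    exact linv_ne_nextLetter _ h2

theorem cornerGlue_pairWord_iff {m : ℕ} [NeZero m] (a b c : Equiv.Perm (Fin m))
    (p q : Fin (pairWord a b c).length) : CornerGlue (pairWord a b c) p q ↔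
      blockPos (pairLetter a b c) q
        = nextPos (partnerPos a b c (blockPos (pairLetter a b c) p)) := by
  unfold CornerGlue pairWord
  constructor
  · rintro ⟨j, hj, hq⟩
    rw [get_blockWord, get_blockWord, pairLetter_eq_linv_iff] at hj
    rw [← hj, ← get_next_blockWord _ _ (hq ▸ q.2)]
    congr 1
    exact Fin.ext hq
  · intro h
    refine ⟨(blockPos _).symm (partnerPos a b c (blockPos (pairLetter a b c) p)), ?_, ?_⟩
    · rw [get_blockWord, get_blockWord, Equiv.apply_symm_apply, pairLetter_partnerPos]
    · rw [← blockPos_symm_nextPos, ← h, Equiv.symm_apply_apply]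

theorem card_quot_eq {α V : Type} {r : α → α → Prop} (f : α → V)
    (hf : ∀ x y, r x y → f x = f y) (s : V → α) (hs : ∀ v, f (s v) = v)
    (hsf : ∀ x, Quot.mk r (s (f x)) = Quot.mk r x) : Nat.card (Quot r) = Nat.card V :=
  Nat.card_congr
    { toFun := Quot.lift f hf
      invFun := fun v => Quot.mk r (s v)
      left_inv := fun q => by induction q using Quot.ind with | mk x => exact hsf x
      right_inv := hs }

/-- The vertex of the glued polygon at a given corner. -/
def vertexPos {m : ℕ} [NeZero m] (a b c : Equiv.Perm (Fin m)) (x : Fin m × Fin 6) :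
    Fin m × Bool :=
  ![(x.1, true), (x.1, false), (c x.1 + 1, true), (a.symm x.1, false), (a.symm x.1, true),
    (b.symm x.1, false)] x.2

/-- The gluing sends corner `(i, 0)` to `(a i, 4)`, then to slot 2, then back to slot 0; `ha` closes
this orbit after three steps. Likewise `hb` closes the orbit through slots 1, 5 and 3. Slots 0 and 1
thus represent all classes. -/
theorem numVertices_pairWord {m : ℕ} [NeZero m] {a b c : Equiv.Perm (Fin m)}
    (hb : ∀ i, b i = c (a i)) (ha : ∀ i, a.symm (b i) = c i + 1) :
    numVertices (pairWord a b c) = 2 * m := by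
  let e := blockPos (pairLetter a b c)
  have hglue : ∀ x : Fin m × Fin 6, Quot.mk (CornerGlue (pairWord a b c))
      (e.symm (nextPos (partnerPos a b c x))) = Quot.mk _ (e.symm x) := fun x =>
    (Quot.sound ((cornerGlue_pairWord_iff a b c _ _).2 (by simp [e]))).symm
  have hcard : Nat.card (Fin m × Bool) = 2 * m := by
    simp [mul_comm]
  rw [← hcard]
  refine card_quot_eq (fun p => vertexPos a b c (e p)) ?_
    (fun v => e.symm (v.1, if v.2 then 0 else 1)) ?_ ?_
  · intro p q hpq
    rw [cornerGlue_pairWord_iff] at hpq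
    simp only [e, hpq]
    generalize blockPos (pairLetter a b c) p = x
    obtain ⟨i, s⟩ := x
    fin_cases s
    · simp [vertexPos, partnerPos, nextPos]
    · simp [vertexPos, partnerPos, nextPos]
    · simp [vertexPos, partnerPos, nextPos]
    · simp [vertexPos, partnerPos, nextPos]
    · simp [vertexPos, partnerPos, nextPos, ← ha]
    · simp [vertexPos, partnerPos, nextPos, Equiv.symm_apply_eq, hb]
  · rintro ⟨i, s⟩
    cases s <;> simp [vertexPos]
  · intro p
    obtain ⟨x, rfl⟩ := e.symm.surjective p
    simp only [Equiv.apply_symm_apply]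
    obtain ⟨i, s⟩ := x
    fin_cases s
    · simp [vertexPos]
    · simp [vertexPos]
    · simpa [vertexPos, partnerPos, nextPos] using hglue (i, 2)
    · simpa [vertexPos, partnerPos, nextPos] using hglue (i, 3)
    · simpa [vertexPos, partnerPos, nextPos] using (hglue (a.symm i, 0)).symm
    · simpa [vertexPos, partnerPos, nextPos] using (hglue (b.symm i, 1)).symm

theorem isMaximalWicksForm_pairWord {k : ℕ} {a b c : Equiv.Perm (Fin (2 * k + 1))}
    (hb : ∀ i, b i = c (a i)) (ha : ∀ i, a.symm (b i) = c i + 1) :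
    IsMaximalWicksForm (k + 1) (pairWord a b c) := by
  have hlen : (pairWord a b c).length = (2 * k + 1) * 6 := length_blockWord _
  refine ⟨⟨isWicksForm_pairWord a b c, ?_⟩, ?_⟩
  · rw [eulerChar, numVertices_pairWord hb ha, hlen]
    omega
  · rw [hlen]
    push_cast
    ring

theorem isNonCancellingWicksRep_pairWord {k : ℕ} {a b c : Equiv.Perm (Fin (2 * k + 1))}
    (hb : ∀ i, b i = c (a i)) (ha : ∀ i, a.symm (b i) = c i + 1) :
    IsNonCancellingWicksRep (k + 1) (fun j => [letterType (j, true)]) (pairWord a b c)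
      (torusWord (2 * k + 1)) := by
  have hsubst : subst (fun j => [letterType (j, true)]) (pairWord a b c)
      = torusWord (2 * k + 1) := by
    have e : ∀ u : Word ℕ, subst (fun j => [letterType (j, true)]) u = u.map letterType := by
      intro u
      unfold subst
      rw [List.map_eq_flatMap]
      congr 1
      funext ⟨j, s⟩
      cases s <;> rfl
    rw [e, pairWord, blockWord, List.map_ofFn]
    unfold torusWord blockWord
    congr 1
    funext q
    exact letterType_pairLetter a b c _
  refine ⟨(isMaximalWicksForm_pairWord hb ha).1, _, List.IsRotated.refl _,
    ⟨fun j => FreeGroup.IsReduced.singleton, ?_⟩, ?_⟩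
  · rw [hsubst]
    exact (isReduced_of_isRotated_torusWord (List.IsRotated.refl _)).reduce_eq
  · rw [hsubst]
    exact fun v hv => isReduced_of_isRotated_torusWord hv

/-- A rotated relabelling determines the pairing. -/
theorem eq_of_rotate_map {m : ℕ} [NeZero m] {a b c a₁ b₁ c₁ a₂ b₂ c₂ : Equiv.Perm (Fin m)}
    {σ₁ σ₂ : Letter ℕ ≃ Letter ℕ} (h₁ : ∀ x, σ₁ (linv x) = linv (σ₁ x))
    (h₂ : ∀ x, σ₂ (linv x) = linv (σ₂ x)) {r : ℕ}
    (e₁ : ((pairWord a b c).map σ₁).rotate r = pairWord a₁ b₁ c₁)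
    (e₂ : ((pairWord a b c).map σ₂).rotate r = pairWord a₂ b₂ c₂) : c₁ = c₂ := by
  have key : ∀ {a₁ b₁ c₁ : Equiv.Perm (Fin m)} {σ : Letter ℕ ≃ Letter ℕ}
      (_ : ((pairWord a b c).map σ).rotate r = pairWord a₁ b₁ c₁) (x : Fin m × Fin 6),
      pairLetter a₁ b₁ c₁ x = σ ((pairWord a b c)[(((x.2 : ℕ) + 6 * x.1) + r) % (m * 6)]'(by
        unfold pairWord
        rw [length_blockWord]
        exact Nat.mod_lt _ (by have := Nat.pos_of_ne_zero (NeZero.ne m); omega))) := by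
    intro a₁ b₁ c₁ σ h x
    have hlen : (pairWord a b c).length = m * 6 := length_blockWord _
    have e : pairLetter a₁ b₁ c₁ x = (pairWord a₁ b₁ c₁).get
        ((blockPos (pairLetter a₁ b₁ c₁)).symm x) := by
      unfold pairWord
      rw [get_blockWord, Equiv.apply_symm_apply]
    rw [e, List.get_eq_getElem]
    simp only [← h, List.getElem_rotate, blockPos_symm_val, List.getElem_map, List.length_map,
      hlen]
  ext i
  -- Both relabelled words read the same positions of `pairWord a b c`. Inverse letters there are
  -- detected equally through `σ₁` and `σ₂`, so the partners of slot 2, which are the values of `c₁`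
  -- and `c₂`, agree.
  have h := pairLetter_partnerPos a₁ b₁ c₁ (i, 2)
  rw [key e₁, key e₁, ← h₁, σ₁.apply_eq_iff_eq] at h
  have h' := congrArg σ₂ h
  rw [h₂, ← key e₂, ← key e₂, pairLetter_eq_linv_iff] at h'
  simpa [partnerPos, Fin.ext_iff] using h'


/-! ### Signed permutations as solutions of the pairing equations -/

/-- Numbering of `Fin (2 * k + 1)` such that exchanging the signs is the reflection `i ↦ -i`. -/
def negNumbering (k : ℕ) : Option (Fin k × Bool) → Fin (2 * k + 1)
  | none => 0
  | some (j, true) => ⟨j + 1, by omega⟩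
  | some (j, false) => ⟨2 * k - j, by omega⟩

/-- Numbering of `Fin (2 * k + 1)` such that exchanging the signs is the reflection
`i ↦ -1 - i`. -/
def revNumbering (k : ℕ) : Option (Fin k × Bool) → Fin (2 * k + 1)
  | none => ⟨k, by omega⟩
  | some (j, true) => ⟨j, by omega⟩
  | some (j, false) => ⟨2 * k - j, by omega⟩

theorem card_numbering (k : ℕ) :
    Fintype.card (Option (Fin k × Bool)) = Fintype.card (Fin (2 * k + 1)) := by
  simp [mul_comm]

theorem negNumbering_bijective (k : ℕ) : Function.Bijective (negNumbering k) := by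
  refine (Fintype.bijective_iff_injective_and_card _).2 ⟨?_, card_numbering k⟩
  rintro (_ | ⟨i, _ | _⟩) (_ | ⟨j, _ | _⟩) h <;> simp [negNumbering, Fin.ext_iff] at h ⊢ <;> omega

theorem revNumbering_bijective (k : ℕ) : Function.Bijective (revNumbering k) := by
  refine (Fintype.bijective_iff_injective_and_card _).2 ⟨?_, card_numbering k⟩
  rintro (_ | ⟨i, _ | _⟩) (_ | ⟨j, _ | _⟩) h <;> simp [revNumbering, Fin.ext_iff] at h ⊢ <;> omega

/-- Exchange of signs. -/
def flipSign {k : ℕ} : Option (Fin k × Bool) → Option (Fin k × Bool) :=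
  Option.map fun x => (x.1, !x.2)

theorem neg_negNumbering {k : ℕ} (x : Option (Fin k × Bool)) :
    - negNumbering k x = negNumbering k (flipSign x) := by
  rcases x with _ | ⟨j, _ | _⟩ <;> simp only [negNumbering, flipSign, Option.map_none,
    Option.map_some, Bool.not_true, Bool.not_false, neg_zero, Fin.ext_iff, Fin.val_neg'] <;>
    have := j.2
  · rw [Nat.mod_eq_of_lt (by omega)]; omega
  · rw [Nat.mod_eq_of_lt (by omega)]; omega

theorem neg_revNumbering_flipSign {k : ℕ} (x : Option (Fin k × Bool)) :
    - revNumbering k (flipSign x) = revNumbering k x + 1 := by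
  rcases x with _ | ⟨j, _ | _⟩
  · simp only [revNumbering, flipSign, Option.map_none, Fin.ext_iff, Fin.val_neg', Fin.val_add,
      Fin.val_one', Nat.add_mod_mod]
    congr 1; omega
  · have := j.2
    simp only [revNumbering, flipSign, Option.map_some, Fin.ext_iff, Fin.val_neg', Fin.val_add,
      Fin.val_one', Nat.add_mod_mod, Bool.not_false]
    congr 1; omega
  · have := j.2
    simp only [revNumbering, flipSign, Option.map_some, Fin.ext_iff, Fin.val_neg', Fin.val_add,
      Fin.val_one', Nat.add_mod_mod, Bool.not_true]
    rw [show 2 * k + 1 - (2 * k - (j : ℕ)) = j + 1 by omega]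

/-- The signed permutation with given underlying permutation and signs. -/
def signedPerm {k : ℕ} (t : Equiv.Perm (Fin k) × (Fin k → Bool)) :
    Equiv.Perm (Option (Fin k × Bool)) :=
  Equiv.optionCongr
    { toFun := fun x => (t.1 x.1, xor (t.2 x.1) x.2)
      invFun := fun x => (t.1.symm x.1, xor (t.2 (t.1.symm x.1)) x.2)
      left_inv := fun x => by simp
      right_inv := fun x => by simp }

theorem signedPerm_some {k : ℕ} (t : Equiv.Perm (Fin k) × (Fin k → Bool)) (j : Fin k)
    (s : Bool) : signedPerm t (some (j, s)) = some (t.1 j, xor (t.2 j) s) := rfl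

theorem signedPerm_flipSign {k : ℕ} (t : Equiv.Perm (Fin k) × (Fin k → Bool))
    (x : Option (Fin k × Bool)) : signedPerm t (flipSign x) = flipSign (signedPerm t x) := by
  rcases x with _ | ⟨j, s⟩
  · rfl
  · simp [flipSign, signedPerm_some]

theorem signedPerm_injective {k : ℕ} : Function.Injective (signedPerm (k := k)) := by
  rintro ⟨π, ε⟩ ⟨π', ε'⟩ h
  have h1 : ∀ j, signedPerm (π, ε) (some (j, false)) = signedPerm (π', ε') (some (j, false)) :=
    fun j => by rw [h]
  simp only [signedPerm_some, Option.some.injEq, Prod.mk.injEq, Bool.xor_false] at h1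
  ext j
  · simp [(h1 j).1]
  · simp [(h1 j).2]

/-- The permutation of `Fin (2 * k + 1)` given by a signed permutation, which takes the reflection
`i ↦ -i` to the reflection `i ↦ -1 - i`. -/
noncomputable def twistPerm {k : ℕ} (t : Equiv.Perm (Fin k) × (Fin k → Bool)) :
    Equiv.Perm (Fin (2 * k + 1)) :=
  (Equiv.ofBijective _ (negNumbering_bijective k)).symm.trans
    ((signedPerm t).trans (Equiv.ofBijective _ (revNumbering_bijective k)))

theorem twistPerm_negNumbering {k : ℕ} (t : Equiv.Perm (Fin k) × (Fin k → Bool))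
    (x : Option (Fin k × Bool)) :
    twistPerm t (negNumbering k x) = revNumbering k (signedPerm t x) := by
  simp [twistPerm, Equiv.ofBijective_symm_apply_apply]

/-- This is the condition `a⁻¹ ∘ b = c + 1` for `a = -id` and `b = c ∘ a`. -/
theorem neg_twistPerm_neg {k : ℕ} (t : Equiv.Perm (Fin k) × (Fin k → Bool))
    (i : Fin (2 * k + 1)) : - twistPerm t (-i) = twistPerm t i + 1 := by
  obtain ⟨x, rfl⟩ := (negNumbering_bijective k).2 i
  rw [neg_negNumbering, twistPerm_negNumbering, twistPerm_negNumbering, signedPerm_flipSign,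
    neg_revNumbering_flipSign]

theorem twistPerm_injective {k : ℕ} : Function.Injective (twistPerm (k := k)) := by
  intro t t' h
  apply signedPerm_injective
  ext1 x
  apply (revNumbering_bijective k).1
  rw [← twistPerm_negNumbering, ← twistPerm_negNumbering, h]

/-- The Wicks form given by a signed permutation. -/
noncomputable abbrev twistWord {k : ℕ} (t : Equiv.Perm (Fin k) × (Fin k → Bool)) : Word ℕ :=
  pairWord (Equiv.neg (Fin (2 * k + 1))) ((Equiv.neg _).trans (twistPerm t)) (twistPerm t)

theorem isMaximalWicksForm_twistWord {k : ℕ} (t : Equiv.Perm (Fin k) × (Fin k → Bool)) :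
    IsMaximalWicksForm (k + 1) (twistWord t) :=
  isMaximalWicksForm_pairWord (fun _ => rfl) (neg_twistPerm_neg t)

theorem isNonCancellingWicksRep_twistWord {k : ℕ} (t : Equiv.Perm (Fin k) × (Fin k → Bool)) :
    IsNonCancellingWicksRep (k + 1) (fun j => [letterType (j, true)]) (twistWord t)
      (torusWord (2 * k + 1)) :=
  isNonCancellingWicksRep_pairWord (fun _ => rfl) (neg_twistPerm_neg t)

theorem hasGenus_torusWord (k : ℕ) : HasGenus (torusWord (2 * k + 1)) (k + 1) := by
  refine ⟨⟨_, _, isNonCancellingWicksRep_twistWord (1, fun _ => true)⟩, ?_⟩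
  rintro l hl ⟨Φ, u, h⟩
  -- The turn sum is `6 (2k + 1) - 1 = 12k + 5`, whereas genus `l ≤ k` allows at most `12k + 3`.
  have h1 := (abs_le.1 (abs_turnSum_le_of_isWicksRep abs_torusTurn_le torusTurn_linv h)).2
  have h2 := turnSum_torusWord (2 * k + 1)
  push_cast at h2
  omega

/-! ### Counting isomorphism classes -/

/-- The isomorphism class of the Wicks form of a signed permutation. -/
noncomputable def twistClass {k : ℕ} (t : Equiv.Perm (Fin k) × (Fin k → Bool)) :
    Quotient (isoSetoid (k + 1)) :=
  Quotient.mk _ ⟨twistWord t, isMaximalWicksForm_twistWord t⟩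

/-- Relative to a fixed member `t₀` of the class, a member is determined by the amount of rotation,
which ranges from 0 to the length inclusive. -/
theorem card_filter_twistClass_le {k : ℕ} [DecidableEq (Quotient (isoSetoid (k + 1)))]
    (I : Quotient (isoSetoid (k + 1))) :
    (Finset.univ.filter fun t : Equiv.Perm (Fin k) × (Fin k → Bool) => twistClass t = I).card
      ≤ (2 * k + 1) * 6 + 1 := by
  rcases (Finset.univ.filter fun t : Equiv.Perm (Fin k) × (Fin k → Bool) =>
    twistClass t = I).eq_empty_or_nonempty with h | ⟨t₀, ht₀⟩
  · rw [h]; simp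
  · have h : ∀ t : Equiv.Perm (Fin k) × (Fin k → Bool), twistClass t = I →
        ∃ r ≤ (2 * k + 1) * 6, ∃ σ : Letter ℕ ≃ Letter ℕ, (∀ x, σ (linv x) = linv (σ x)) ∧
          ((twistWord t₀).map σ).rotate r = twistWord t := by
      intro t ht
      have e : twistClass t₀ = twistClass t := by
        rw [ht]; simpa using ht₀
      obtain ⟨σ, hσ, hr⟩ := Quotient.exact e
      obtain ⟨r, hr, hr'⟩ := List.isRotated_iff_mod.1 hr
      refine ⟨r, ?_, σ, hσ, hr'⟩
      rwa [List.length_map, length_blockWord] at hr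
    choose! r hr σ hσ hrσ using h
    rw [← Finset.card_range ((2 * k + 1) * 6 + 1)]
    refine Finset.card_le_card_of_injOn r ?_ ?_
    · intro t ht
      have := hr t (by simpa using ht)
      simp
      omega
    · intro t ht t' ht' htt'
      have ht : twistClass t = I := by simpa using ht
      have ht' : twistClass t' = I := by simpa using ht'
      apply twistPerm_injective
      have e := hrσ t ht
      rw [htt'] at e
      exact eq_of_rotate_map (hσ t ht) (hσ t' ht') e (hrσ t' ht')

theorem card_le_mul_of_M_le {k N : ℕ} (h : M (k + 1) (torusWord (2 * k + 1)) ≤ N) :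
    k.factorial * 2 ^ k ≤ ((2 * k + 1) * 6 + 1) * N := by
  classical
  have h1 := Finset.card_le_mul_card_image (f := twistClass (k := k)) Finset.univ
    ((2 * k + 1) * 6 + 1) fun I _ => card_filter_twistClass_le I
  rw [Finset.card_univ, Fintype.card_prod, Fintype.card_perm, Fintype.card_fun, Fintype.card_fin,
    Fintype.card_bool] at h1
  refine h1.trans (Nat.mul_le_mul_left _ ?_)
  have h2 : ((Finset.univ.image (twistClass (k := k)) : Finset _) :
      Set (Quotient (isoSetoid (k + 1)))).encard ≤ N := by
    refine le_trans (Set.encard_le_encard ?_) h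
    intro I hI
    simp only [Finset.coe_image, Finset.coe_univ, Set.image_univ, Set.mem_range] at hI
    obtain ⟨t, rfl⟩ := hI
    exact ⟨_, rfl, _, isNonCancellingWicksRep_twistWord t⟩
  rw [Set.encard_coe_eq_coe_finsetCard] at h2
  exact_mod_cast h2

theorem quadratic_lt_two_pow {k : ℕ} (hk : 20 ≤ k) :
    ((2 * k + 1) * 6 + 1) * (k + 1) < 2 ^ k := by
  induction k, hk using Nat.le_induction with
  | base => norm_num
  | succ k hk ih =>
    rw [pow_succ]
    nlinarith

end WicksForms

theorem theorem1 :
    ∃ w : ℕ → WicksForms.Word (Fin 12),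
      (∀ g : ℕ, 2 ≤ g → WicksForms.HasGenus (w g) g) ∧
      (∀ g : ℕ, 10 ^ 10 < g → (Nat.factorial g : ℕ∞) < WicksForms.M g (w g)) := by
  refine ⟨fun g => WicksForms.torusWord (2 * (g - 1) + 1), fun g hg => ?_, fun g hg => ?_⟩
  · obtain ⟨k, rfl⟩ := Nat.exists_eq_add_of_le' (show 1 ≤ g by omega)
    exact WicksForms.hasGenus_torusWord k
  · obtain ⟨k, rfl⟩ := Nat.exists_eq_add_of_le' (show 1 ≤ g by omega)
    by_contra! h
    have h1 := WicksForms.card_le_mul_of_M_le h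
    have h2 := WicksForms.quadratic_lt_two_pow (show 20 ≤ k by omega)
    rw [Nat.factorial_succ] at h1
    -- With `g! = (k + 1) k!`, the factor `k!` is common to both sides, leaving `2 ^ k` against a
    -- quadratic in `k`.
    have h3 := Nat.mul_lt_mul_of_pos_left h2 k.factorial_pos
    rw [← mul_assoc] at h1
    rw [mul_comm _ k.factorial] at h1
    omega
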